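/- Let $a,b$ be integers with $2\le a\le b-2$, let $\rho$ be a root of the polynomial $$f(x)=x^3-(a+b)x^2+abx-1,$$ and let $K=\mathbb Q(\rho)$, which is a totally real cubic field. An element of $K$ is totally positive if all its images under the embeddings $K\to\mathbb R$ are positive. An indecomposable integer in $\mathbb Z[\rho]$ is a totally positive element of $\mathbb Z[\rho]$ that is not the sum of two totally positive elements of $\mathbb Z[\rho]$. Let $\mathbb Z[\rho]^{\vee,+}$ denote the set of totally positive elements of the codifferent $$\mathbb Z[\rho]^{\vee}=\{\delta\in K:\ \mathrm{Tr}_{K/\mathbb Q}(\alpha\delta)\in\mathbb Z\ \text{for all}\ \alpha\in\mathbb Z[\rho]\}.$$ Then for every indecomposable integer $\alpha$ in $\mathbb Z[\rho]$ the minimum below exists and $$\min_{\delta\in\mathbb Z[\rho]^{\vee,+}}\mathrm{Tr}_{K/\mathbb Q}(\alpha\delta)\le\min\{b-a+1,\,a\}.$$ Moreover, this bound is attained: there is an indecomposable integer $\alpha$ in $\mathbb Z[\rho]$ with $$\min_{\delta\in\mathbb Z[\rho]^{\vee,+}}\mathrm{Tr}_{K/\mathbb Q}(\alpha\delta)=\min\{b-a+1,\,a\}.$$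 -/

import Mathlib

open Polynomial

/-- An element of a field is totally positive if its image under every embedding of the field
into `ℝ` is positive. (It is used below only for totally real number fields.) -/
def TotallyPositive {K : Type*} [Field K] (α : K) : Prop :=
  ∀ σ : K →+* ℝ, 0 < σ α

/-- `α` is an indecomposable integer of `O`: a totally positive element of `O` that is not a sum
of two totally positive elements of `O`. -/
def IsIndecomposableIn {K : Type*} [Field K] (O : Subalgebra ℤ K) (α : K) : Prop :=
  (α ∈ O ∧ TotallyPositive α) ∧
    ¬ ∃ β γ : K, (β ∈ O ∧ TotallyPositive β) ∧ (γ ∈ O ∧ TotallyPositive γ) ∧ α = β + γ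

/-- The codifferent of `O`: the elements `δ` of `K` such that `Tr(α δ)` is a rational integer
for all `α ∈ O`. -/
def codifferent {K : Type*} [Field K] [NumberField K] (O : Subalgebra ℤ K) : Set K :=
  {δ | ∀ α ∈ O, ∃ n : ℤ, Algebra.trace ℚ K (α * δ) = (n : ℚ)}

/-- The set of all traces `Tr(α δ)`, for `δ` a totally positive element of the codifferent
of `O`. -/
def codifferentTraces {K : Type*} [Field K] [NumberField K] (O : Subalgebra ℤ K) (α : K) :
    Set ℚ :=
  {t | ∃ δ : K, δ ∈ codifferent O ∧ TotallyPositive δ ∧ t = Algebra.trace ℚ K (α * δ)}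

/-- The polynomial `x³ - (a + b) x² + a b x - 1`. -/
noncomputable def thomasPolynomial (a b : ℤ) : ℤ[X] :=
  X ^ 3 - C (a + b) * X ^ 2 + C (a * b) * X - 1

/-!
Put `c = b - a` and `t = ρ - a`, so that `t (t + a) (t - c) = 1` and `ℤ[ρ] = ℤ[t]` has the basis
`1, t, t²`. The trace form identifies the codifferent with the functionals that are integral on
this basis, and totally positive elements of the codifferent with those that are positive on
totally positive elements (`exists_totallyPositive_trace_mul_eq`). Traces become values of integral
linear forms in the coordinates.

The elements `ρ` and `t²` are totally positive units. Modulo the totally positive units, the cone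
of totally positive elements is covered by two simplicial cones, spanned by `1, ρ, ρ t²` and by
`1, ρ t², t²` (`exists_unit_mul_mem_cone`). To see this, consider the functional of each cone that
is constant on its generators, and take the cone and the unit multiple of a given element for
which the value is smallest. The comparison with the three adjacent triangles says exactly that
the coefficients of that multiple are nonnegative.

In the first cone all indecomposables have height `1`. In the second one, apart from units, they
are `1 + y t + z t²` with `0 ≤ a z - y < a` and `z ≤ c`
(`IsIndecomposableIn.coords_of_inConeTwo`). The functionals with values `1, -1, a` and `1, 0, 1` at
`1, t, t²` take the values `1 + (a z - y) ≤ a` and `1 + z ≤ c + 1` there, which gives the bound.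

The bound is attained at `ρ t² - (a - 1) t`. Its height with respect to the second cone is
`2 - 1 / a`, while every totally positive element of the order has height at least `1`
(`le_height_of_totallyPositive`), so it is indecomposable. For a functional positive at the units
`1`, `t²`, `ρ t²`, the value at this element is at least `a` if the functional is negative at `t`,
and at least `c + 1` otherwise (`min_le_trace_extremal`).
-/

/-! ### The cubic field and its real embeddings -/

/-- The polynomial `t (t + a) (t - c) - 1`, which is the Thomas polynomial with `b = a + c` in the
variable `t = x - a`. -/
noncomputable def shiftedThomas (a c : ℤ) : ℤ[X] :=
  X ^ 3 + (C (a - c) * X ^ 2 + C (-(a * c)) * X + C (-1))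

lemma natDegree_shiftedThomas (a c : ℤ) : (shiftedThomas a c).natDegree = 3 := by
  unfold shiftedThomas; compute_degree!

lemma monic_shiftedThomas (a c : ℤ) : (shiftedThomas a c).Monic := by
  unfold shiftedThomas; monicity!

lemma aeval_shiftedThomas {R : Type*} [CommRing R] (a c : ℤ) (x : R) :
    aeval x (shiftedThomas a c) = x * (x + a) * (x - c) - 1 := by
  simp [shiftedThomas]; ring

lemma irreducible_shiftedThomas {a c : ℤ} (ha : 2 ≤ a) (hc : 2 ≤ c) :
    Irreducible (shiftedThomas a c) := by
  rw [(monic_shiftedThomas a c).irreducible_iff_roots_eq_zero_of_degree_le_three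
    (by rw [natDegree_shiftedThomas]; norm_num) (by rw [natDegree_shiftedThomas])]
  refine Multiset.eq_zero_of_forall_notMem fun n hn => ?_
  have h := (mem_roots'.1 hn).2
  rw [IsRoot, ← coe_aeval_eq_eval, aeval_shiftedThomas] at h
  simp only [Int.cast_id] at h
  have h1 : n * ((n + a) * (n - c)) = 1 := by linarith
  rcases Int.eq_one_or_neg_one_of_mul_eq_one h1 with rfl | rfl
  · have : (1 + a) * (1 - c) = 1 := by linarith
    nlinarith
  · have : (a - 1) * (c + 1) = 1 := by linarith
    nlinarith

section Field

variable {K : Type*} [Field K] [NumberField K] {a c : ℤ} {t : K}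

lemma minpoly_eq_shiftedThomas (ha : 2 ≤ a) (hc : 2 ≤ c) (ht : t * (t + a) * (t - c) = 1) :
    minpoly ℚ t = (shiftedThomas a c).map (algebraMap ℤ ℚ) := by
  refine (minpoly.eq_of_irreducible_of_monic ?_ ?_ ((monic_shiftedThomas a c).map _)).symm
  · exact (monic_shiftedThomas a c).irreducible_iff_irreducible_map_fraction_map.1
      (irreducible_shiftedThomas ha hc)
  · rw [aeval_map_algebraMap, aeval_shiftedThomas, ht, sub_self]

lemma exists_powerBasis_gen_eq (hK : IntermediateField.adjoin ℚ {t} = ⊤) :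
    ∃ pb : PowerBasis ℚ K, pb.gen = t ∧ pb.dim = (minpoly ℚ t).natDegree := by
  have hint : IsIntegral ℚ t := Algebra.IsIntegral.isIntegral t
  have htop : Algebra.adjoin ℚ {t} = ⊤ := by
    rw [← IntermediateField.adjoin_simple_toSubalgebra_of_isAlgebraic hint.isAlgebraic, hK]
    rfl
  exact ⟨PowerBasis.ofAdjoinEqTop hint htop, by simp, by simp⟩

lemma exists_shiftedThomas_roots (ha : 2 ≤ a) (hc : 2 ≤ c) :
    ∃ r₁ r₂ r₃ : ℝ, (r₁ * (r₁ + a) * (r₁ - c) = 1 ∧ -a < r₁ ∧ r₁ < -1) ∧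
      (r₂ * (r₂ + a) * (r₂ - c) = 1 ∧ -1 < r₂ ∧ r₂ < 0) ∧
      (r₃ * (r₃ + a) * (r₃ - c) = 1 ∧ c < r₃ ∧ r₃ < c + 1) := by
  have ha' : (2 : ℝ) ≤ a := by exact_mod_cast ha
  have hc' : (2 : ℝ) ≤ c := by exact_mod_cast hc
  let g : ℝ → ℝ := fun x => x * (x + a) * (x - c)
  have hg : ∀ s, ContinuousOn g s := fun s => by fun_prop
  obtain ⟨r₁, h₁, e₁⟩ := intermediate_value_Ioo (a := -(a : ℝ)) (b := -1) (by linarith) (hg _)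
    (show (1 : ℝ) ∈ Set.Ioo _ _ from ⟨by simp [g], by simp only [g]; nlinarith⟩)
  obtain ⟨r₂, h₂, e₂⟩ := intermediate_value_Ioo' (a := (-1 : ℝ)) (b := 0) (by linarith) (hg _)
    (show (1 : ℝ) ∈ Set.Ioo _ _ from ⟨by simp [g], by simp only [g]; nlinarith⟩)
  obtain ⟨r₃, h₃, e₃⟩ := intermediate_value_Ioo (a := (c : ℝ)) (b := c + 1) (by linarith) (hg _)
    (show (1 : ℝ) ∈ Set.Ioo _ _ from ⟨by simp [g], by simp only [g]; nlinarith⟩)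
  exact ⟨r₁, r₂, r₃, ⟨e₁, h₁⟩, ⟨e₂, h₂⟩, ⟨e₃, h₃⟩⟩

/-- The field has exactly three embeddings into `ℝ`, they send `t` near `-a`, `0` and `c`, and the
trace is their sum. -/
lemma exists_real_embeddings (ha : 2 ≤ a) (hc : 2 ≤ c) (ht : t * (t + a) * (t - c) = 1)
    (hK : IntermediateField.adjoin ℚ {t} = ⊤) :
    ∃ σ₁ σ₂ σ₃ : K →+* ℝ, (∀ σ : K →+* ℝ, σ = σ₁ ∨ σ = σ₂ ∨ σ = σ₃) ∧
      (∀ x : K, (Algebra.trace ℚ K x : ℝ) = σ₁ x + σ₂ x + σ₃ x) ∧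
      (-a < σ₁ t ∧ σ₁ t < -1) ∧ (-1 < σ₂ t ∧ σ₂ t < 0) ∧ (c < σ₃ t ∧ σ₃ t < c + 1) := by
  have hc' : (2 : ℝ) ≤ c := by exact_mod_cast hc
  obtain ⟨pb, hgen, hdim⟩ := exists_powerBasis_gen_eq hK
  have hmin := minpoly_eq_shiftedThomas ha hc ht
  have hlift : ∀ r : ℝ, r * (r + a) * (r - c) = 1 → ∃ σ : K →ₐ[ℚ] ℝ, σ t = r := by
    intro r hr
    refine ⟨pb.lift r ?_, ?_⟩
    · rw [hgen, hmin, aeval_map_algebraMap, aeval_shiftedThomas, hr, sub_self]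
    · exact (congrArg _ hgen.symm).trans (pb.lift_gen _ _)
  obtain ⟨r₁, r₂, r₃, ⟨e₁, h₁⟩, ⟨e₂, h₂⟩, ⟨e₃, h₃⟩⟩ := exists_shiftedThomas_roots ha hc
  obtain ⟨σ₁, rfl⟩ := hlift r₁ e₁
  obtain ⟨σ₂, rfl⟩ := hlift r₂ e₂
  obtain ⟨σ₃, rfl⟩ := hlift r₃ e₃
  let ι : ℝ →ₐ[ℚ] ℂ := Complex.ofRealAm.restrictScalars ℚ
  have hι : Function.Injective ι := Complex.ofReal_injective
  have n12 : σ₁ ≠ σ₂ := fun h => by rw [h] at h₁; linarith [h₁.2, h₂.1]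
  have n13 : σ₁ ≠ σ₃ := fun h => by rw [h] at h₁; linarith [h₁.2, h₃.1]
  have n23 : σ₂ ≠ σ₃ := fun h => by rw [h] at h₂; linarith [h₂.2, h₃.1]
  have hcomp : ∀ {σ τ : K →ₐ[ℚ] ℝ}, σ ≠ τ → ι.comp σ ≠ ι.comp τ := fun {σ τ} h h' =>
    h (AlgHom.ext fun x => hι (DFunLike.congr_fun h' x))
  classical
  have hfin : Module.finrank ℚ K = 3 := by
    rw [pb.finrank, hdim, hmin, (monic_shiftedThomas a c).natDegree_map, natDegree_shiftedThomas]
  have huniv : ({ι.comp σ₁, ι.comp σ₂, ι.comp σ₃} : Finset (K →ₐ[ℚ] ℂ)) = Finset.univ := by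
    rw [← Finset.card_eq_iff_eq_univ, AlgHom.card ℚ K ℂ, hfin, Finset.card_eq_three]
    exact ⟨_, _, _, hcomp n12, hcomp n13, hcomp n23, rfl⟩
  refine ⟨σ₁, σ₂, σ₃, fun σ => ?_, fun x => ?_, h₁, h₂, h₃⟩
  · have hmem := Finset.mem_univ (ι.comp σ.toRatAlgHom)
    rw [← huniv] at hmem
    simp only [Finset.mem_insert, Finset.mem_singleton] at hmem
    have key : ∀ τ : K →ₐ[ℚ] ℝ, ι.comp σ.toRatAlgHom = ι.comp τ → σ = τ := fun τ h =>
      RingHom.ext fun x => hι (DFunLike.congr_fun h x)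
    exact hmem.imp (key _) (Or.imp (key _) (key _))
  · have h := trace_eq_sum_embeddings (K := ℚ) (L := K) ℂ (x := x)
    rw [← huniv, Finset.sum_insert (by simp [hcomp n12, hcomp n13]),
      Finset.sum_insert (by simp [hcomp n23]), Finset.sum_singleton] at h
    have h' : (((Algebra.trace ℚ K x : ℚ) : ℝ) : ℂ) = ((σ₁ x + σ₂ x + σ₃ x : ℝ) : ℂ) := by
      push_cast
      rw [add_assoc]
      exact h
    exact_mod_cast h'

/-- Every linear functional, given by its values at `1`, `t`, `t²`, is the trace against some
element of the field. -/
lemma exists_trace_mul_eq (ha : 2 ≤ a) (hc : 2 ≤ c) (ht : t * (t + a) * (t - c) = 1)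
    (hK : IntermediateField.adjoin ℚ {t} = ⊤) (p q r : ℤ) :
    ∃ δ : K, ∀ x y z : ℤ,
      Algebra.trace ℚ K ((x + y * t + z * t ^ 2) * δ) = ((p * x + q * y + r * z : ℤ) : ℚ) := by
  obtain ⟨pb, hgen, hdim⟩ := exists_powerBasis_gen_eq hK
  rw [minpoly_eq_shiftedThomas ha hc ht, (monic_shiftedThomas a c).natDegree_map,
    natDegree_shiftedThomas] at hdim
  let B := pb.basis.reindex (finCongr hdim)
  have hB : ∀ i : Fin 3, B i = t ^ (i : ℕ) := fun i => by simp [B, hgen]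
  obtain ⟨φ, hφ⟩ : ∃ φ : K →ₗ[ℚ] ℚ, ∀ i, φ (B i) = ![(p : ℚ), q, r] i :=
    ⟨B.constr ℚ ![(p : ℚ), q, r], fun i => B.constr_basis ℚ _ i⟩
  have h0 : φ 1 = p := by simpa [hB] using hφ 0
  have h1 : φ t = q := by simpa [hB] using hφ 1
  have h2 : φ (t ^ 2) = r := by simpa [hB] using hφ 2
  have hnd := traceForm_nondegenerate ℚ K
  obtain ⟨δ, hδ⟩ := ((Algebra.traceForm ℚ K).toDual hnd).surjective φ
  refine ⟨δ, fun x y z => ?_⟩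
  have e : (x + y * t + z * t ^ 2 : K) = (x : ℚ) • (1 : K) + (y : ℚ) • t + (z : ℚ) • t ^ 2 := by
    simp [Algebra.smul_def]
  rw [mul_comm, ← Algebra.traceForm_apply, ← LinearMap.BilinForm.toDual_def hnd, hδ, e]
  simp only [map_add, map_smul, h0, h1, h2, smul_eq_mul]
  push_cast
  ring

end Field

/-! ### Functionals given by totally positive elements -/

section Functionals

lemma embedding_root {K : Type*} [Field K] {a c : ℤ} {t : K} (ht : t * (t + a) * (t - c) = 1)
    (σ : K →+* ℝ) : σ t * (σ t + a) * (σ t - c) = 1 := by simpa using congrArg σ ht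

variable {K : Type*} [Field K] [NumberField K] {a c : ℤ} {t : K}

/-- Vieta's formula for the product of the roots. -/
lemma mul_mul_eq_one_of_roots {a c t₁ t₂ t₃ : ℝ} (e₁ : t₁ * (t₁ + a) * (t₁ - c) = 1)
    (e₂ : t₂ * (t₂ + a) * (t₂ - c) = 1) (e₃ : t₃ * (t₃ + a) * (t₃ - c) = 1)
    (h₁₂ : t₁ < t₂) (h₂₃ : t₂ < t₃) : t₁ * t₂ * t₃ = 1 := by
  have q₁ : t₁ ^ 2 + t₁ * t₂ + t₂ ^ 2 + (a - c) * (t₁ + t₂) - a * c = 0 :=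
    mul_left_cancel₀ (sub_ne_zero.2 h₁₂.ne) (by linear_combination e₁ - e₂)
  have q₃ : t₂ ^ 2 + t₂ * t₃ + t₃ ^ 2 + (a - c) * (t₂ + t₃) - a * c = 0 :=
    mul_left_cancel₀ (sub_ne_zero.2 h₂₃.ne) (by linear_combination e₂ - e₃)
  have s : t₁ + t₂ + t₃ + a - c = 0 :=
    mul_left_cancel₀ (sub_ne_zero.2 (h₁₂.trans h₂₃).ne) (by linear_combination q₁ - q₃)
  linear_combination e₁ - t₁ * q₁ + t₁ * t₂ * s

/-- A functional with values `p`, `q`, `r` at `1`, `t`, `t²` is the trace against a totally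
positive `δ` as soon as its values at the products `(t - tⱼ) (t - tₖ)` have the right signs,
because these values are `σᵢ δ (tᵢ - tⱼ) (tᵢ - tₖ)`. -/
lemma exists_totallyPositive_trace_mul_eq (ha : 2 ≤ a) (hc : 2 ≤ c)
    (ht : t * (t + a) * (t - c) = 1) (hK : IntermediateField.adjoin ℚ {t} = ⊤) (p q r : ℤ)
    (H : ∀ t₁ t₂ t₃ : ℝ, 0 < t₁ + a → 3 * (t₁ + a) < 1 → (t₁ + a) * (c - t₁) < 1 →
      -1 < t₂ → t₂ < 0 → c < t₃ → t₃ < c + 1 → 0 < 1 + t₂ * t₃ → 1 + t₁ * t₃ < 0 →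
      0 < r - (t₂ + t₃) * q + t₂ * t₃ * p ∧ r - (t₁ + t₃) * q + t₁ * t₃ * p < 0 ∧
        0 < r - (t₁ + t₂) * q + t₁ * t₂ * p) :
    ∃ δ : K, TotallyPositive δ ∧ ∀ x y z : ℤ,
      Algebra.trace ℚ K ((x + y * t + z * t ^ 2) * δ) = ((p * x + q * y + r * z : ℤ) : ℚ) := by
  obtain ⟨δ, hδ⟩ := exists_trace_mul_eq ha hc ht hK p q r
  refine ⟨δ, ?_, hδ⟩
  obtain ⟨σ₁, σ₂, σ₃, hσ, htr, h₁, h₂, h₃⟩ := exists_real_embeddings ha hc ht hK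
  have ha' : (2 : ℝ) ≤ a := by exact_mod_cast ha
  have hc' : (2 : ℝ) ≤ c := by exact_mod_cast hc
  have e₁ := embedding_root ht σ₁
  have e₂ := embedding_root ht σ₂
  have e₃ := embedding_root ht σ₃
  have hsum : ∀ x y z : ℤ, (x + y * σ₁ t + z * σ₁ t ^ 2) * σ₁ δ +
      (x + y * σ₂ t + z * σ₂ t ^ 2) * σ₂ δ + (x + y * σ₃ t + z * σ₃ t ^ 2) * σ₃ δ =
      p * x + q * y + r * z := fun x y z => by
    have h := htr ((x + y * t + z * t ^ 2) * δ)
    rw [hδ] at h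
    simp only [map_mul, map_add, map_pow, map_intCast] at h
    rw [← h]
    push_cast
    rfl
  have w0 := hsum 1 0 0
  have w1 := hsum 0 1 0
  have w2 := hsum 0 0 1
  push_cast at w0 w1 w2
  have V := mul_mul_eq_one_of_roots e₁ e₂ e₃ (by linarith) (by linarith)
  obtain ⟨h₁a, h₁b⟩ := h₁
  obtain ⟨h₂a, h₂b⟩ := h₂
  obtain ⟨h₃a, h₃b⟩ := h₃
  generalize σ₁ t = t₁ at *
  generalize σ₂ t = t₂ at *
  generalize σ₃ t = t₃ at *
  have hpos : 0 < t₁ + a := by linarith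
  have k₁ : (t₁ + a) * (c - t₁) < 1 := by
    have : (-t₁) * ((t₁ + a) * (c - t₁)) = 1 := by linear_combination e₁
    nlinarith [mul_pos hpos (show 0 < c - t₁ by linarith)]
  have k₂ : 3 * (t₁ + a) < 1 := by nlinarith
  have k₃ : 0 < 1 + t₂ * t₃ := by nlinarith
  have k₄ : 1 + t₁ * t₃ < 0 := by nlinarith
  obtain ⟨H₁, H₂, H₃⟩ := H t₁ t₂ t₃ hpos k₂ k₁ h₂a h₂b h₃a h₃b k₃ k₄
  have d₁ : 0 < σ₁ δ := by
    have : σ₁ δ * ((t₁ - t₂) * (t₁ - t₃)) = r - (t₂ + t₃) * q + t₂ * t₃ * p := by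
      linear_combination w2 - (t₂ + t₃) * w1 + t₂ * t₃ * w0
    rw [← this] at H₁
    exact pos_of_mul_pos_left H₁
      (mul_nonneg_of_nonpos_of_nonpos (by linarith) (by linarith))
  have d₂ : 0 < σ₂ δ := by
    have : σ₂ δ * ((t₂ - t₁) * (t₃ - t₂)) = -(r - (t₁ + t₃) * q + t₁ * t₃ * p) := by
      linear_combination -w2 + (t₁ + t₃) * w1 - t₁ * t₃ * w0
    rw [← neg_pos, ← this] at H₂
    exact pos_of_mul_pos_left H₂ (mul_nonneg (by linarith) (by linarith))
  have d₃ : 0 < σ₃ δ := by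
    have : σ₃ δ * ((t₃ - t₁) * (t₃ - t₂)) = r - (t₁ + t₂) * q + t₁ * t₂ * p := by
      linear_combination w2 - (t₁ + t₂) * w1 + t₁ * t₂ * w0
    rw [← this] at H₃
    exact pos_of_mul_pos_left H₃ (mul_nonneg (by linarith) (by linarith))
  intro σ
  rcases hσ σ with rfl | rfl | rfl
  exacts [d₁, d₂, d₃]

lemma trace_mul_pos (ha : 2 ≤ a) (hc : 2 ≤ c) (ht : t * (t + a) * (t - c) = 1)
    (hK : IntermediateField.adjoin ℚ {t} = ⊤) {α δ : K} (hα : TotallyPositive α)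
    (hδ : TotallyPositive δ) : 0 < Algebra.trace ℚ K (α * δ) := by
  obtain ⟨σ₁, σ₂, σ₃, -, htr, -⟩ := exists_real_embeddings ha hc ht hK
  have h := htr (α * δ)
  simp only [map_mul] at h
  have := mul_pos (hα σ₁) (hδ σ₁)
  have := mul_pos (hα σ₂) (hδ σ₂)
  have := mul_pos (hα σ₃) (hδ σ₃)
  have h' : (0 : ℝ) < (Algebra.trace ℚ K (α * δ) : ℝ) := by linarith
  exact_mod_cast h'

/-- The functional that is `1` at the units `1`, `ρ` and `ρ t²`, where `ρ = t + a`. -/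
lemma exists_functional_cone_one (ha : 2 ≤ a) (hc : 2 ≤ c)
    (ht : t * (t + a) * (t - c) = 1) (hK : IntermediateField.adjoin ℚ {t} = ⊤) :
    ∃ δ : K, TotallyPositive δ ∧ ∀ x y z : ℤ, Algebra.trace ℚ K ((x + y * t + z * t ^ 2) * δ) =
      ((1 * x + (-(a - 1)) * y + a * (a - 1) * z : ℤ) : ℚ) := by
  have ha' : (2 : ℝ) ≤ a := by exact_mod_cast ha
  have hc' : (2 : ℝ) ≤ c := by exact_mod_cast hc
  refine exists_totallyPositive_trace_mul_eq ha hc ht hK _ _ _ ?_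
  intro t₁ t₂ t₃ h₁ h₁' h₁'' h₂ h₂' h₃ h₃' k k'
  push_cast
  refine ⟨?_, ?_, ?_⟩
  · nlinarith [mul_pos (show 0 < t₂ + (a - 1) by linarith) (show 0 < t₃ + (a - 1) by linarith)]
  · nlinarith [mul_pos h₁ (show 0 < c + 1 - t₃ by linarith)]
  · nlinarith [mul_pos h₁ (show 0 < t₂ + (a - 1) by linarith)]

/-- The functional that is `a` at the units `1`, `ρ t²` and `t²`, where `ρ = t + a`. -/
lemma exists_functional_cone_two (ha : 2 ≤ a) (hc : 2 ≤ c)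
    (ht : t * (t + a) * (t - c) = 1) (hK : IntermediateField.adjoin ℚ {t} = ⊤) :
    ∃ δ : K, TotallyPositive δ ∧ ∀ x y z : ℤ, Algebra.trace ℚ K ((x + y * t + z * t ^ 2) * δ) =
      ((a * x + (-1) * y + a * z : ℤ) : ℚ) := by
  have ha' : (2 : ℝ) ≤ a := by exact_mod_cast ha
  have hc' : (2 : ℝ) ≤ c := by exact_mod_cast hc
  refine exists_totallyPositive_trace_mul_eq ha hc ht hK _ _ _ ?_
  intro t₁ t₂ t₃ h₁ h₁' h₁'' h₂ h₂' h₃ h₃' k k'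
  push_cast
  refine ⟨?_, ?_, ?_⟩
  · nlinarith
  · have : t₁ * t₃ < -t₃ := by nlinarith
    nlinarith
  · nlinarith [mul_pos (show 0 < -t₂ by linarith) (show 0 < -1 - t₁ by linarith)]

/-- The functional bounding the minimal trace by `a`: at `1 + y t + z t²` its value is
`1 + (a z - y)`. -/
lemma exists_functional_le_left (ha : 2 ≤ a) (hc : 2 ≤ c)
    (ht : t * (t + a) * (t - c) = 1) (hK : IntermediateField.adjoin ℚ {t} = ⊤) :
    ∃ δ : K, TotallyPositive δ ∧ ∀ x y z : ℤ, Algebra.trace ℚ K ((x + y * t + z * t ^ 2) * δ) =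
      ((1 * x + (-1) * y + a * z : ℤ) : ℚ) := by
  have ha' : (2 : ℝ) ≤ a := by exact_mod_cast ha
  have hc' : (2 : ℝ) ≤ c := by exact_mod_cast hc
  refine exists_totallyPositive_trace_mul_eq ha hc ht hK _ _ _ ?_
  intro t₁ t₂ t₃ h₁ h₁' h₁'' h₂ h₂' h₃ h₃' k k'
  push_cast
  refine ⟨?_, ?_, ?_⟩
  · nlinarith
  · nlinarith [mul_pos (show 0 < 1 - 3 * (t₁ + a) by linarith) (show 0 < 1 + t₃ by linarith)]
  · nlinarith [mul_pos h₁ (show 0 < 1 + t₂ by linarith)]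

/-- The functional bounding the minimal trace by `c + 1`: at `1 + y t + z t²` its value is
`1 + z`. -/
lemma exists_functional_le_right (ha : 2 ≤ a) (hc : 2 ≤ c)
    (ht : t * (t + a) * (t - c) = 1) (hK : IntermediateField.adjoin ℚ {t} = ⊤) :
    ∃ δ : K, TotallyPositive δ ∧ ∀ x y z : ℤ, Algebra.trace ℚ K ((x + y * t + z * t ^ 2) * δ) =
      ((1 * x + 0 * y + 1 * z : ℤ) : ℚ) := by
  have ha' : (2 : ℝ) ≤ a := by exact_mod_cast ha
  have hc' : (2 : ℝ) ≤ c := by exact_mod_cast hc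
  refine exists_totallyPositive_trace_mul_eq ha hc ht hK _ _ _ ?_
  intro t₁ t₂ t₃ h₁ h₁' h₁'' h₂ h₂' h₃ h₃' k k'
  push_cast
  refine ⟨by linarith, by linarith, ?_⟩
  nlinarith [mul_pos (show 0 < -t₂ by linarith) (show 0 < -t₁ by linarith)]

end Functionals

/-! ### The order, its totally positive units, and the two cones -/

section Order

variable {K : Type*} [Field K] {a c : ℤ} {t : K}

/-- `1`, `t`, `t²` span the order `ℤ[t]`. -/
lemma mem_adjoin_iff_exists_coords (ht : t * (t + a) * (t - c) = 1) {α : K} :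
    α ∈ Algebra.adjoin ℤ {t} ↔ ∃ x y z : ℤ, α = x + y * t + z * t ^ 2 := by
  constructor
  · intro h
    induction h using Algebra.adjoin_induction with
    | mem α hα => exact ⟨0, 1, 0, by rw [Set.mem_singleton_iff.1 hα]; simp⟩
    | algebraMap n => exact ⟨n, 0, 0, by simp⟩
    | add α β _ _ hα hβ =>
      obtain ⟨x, y, z, rfl⟩ := hα
      obtain ⟨x', y', z', rfl⟩ := hβ
      exact ⟨x + x', y + y', z + z', by push_cast; ring⟩
    | mul α β _ _ hα hβ =>
      obtain ⟨x, y, z, rfl⟩ := hα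
      obtain ⟨x', y', z', rfl⟩ := hβ
      -- Reduce the product with `t ^ 3 = (c - a) t ^ 2 + a c t + 1`.
      refine ⟨x * x' + (y * z' + z * y' + (c - a) * (z * z')),
        x * y' + y * x' + a * c * (y * z' + z * y') + (1 + (c - a) * (a * c)) * (z * z'),
        x * z' + y * y' + z * x' + (c - a) * (y * z' + z * y') +
          ((c - a) ^ 2 + a * c) * (z * z'), ?_⟩
      push_cast
      linear_combination (y * z' + z * y' + z * z' * (t + (c - a)) : K) * ht
  · rintro ⟨x, y, z, rfl⟩
    have h := Algebra.self_mem_adjoin_singleton ℤ t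
    have hn : ∀ n : ℤ, (n : K) ∈ Algebra.adjoin ℤ {t} := fun n => intCast_mem _ n
    exact add_mem (add_mem (hn x) (mul_mem (hn y) h)) (mul_mem (hn z) (pow_mem h 2))

lemma TotallyPositive.add {α β : K} (hα : TotallyPositive α) (hβ : TotallyPositive β) :
    TotallyPositive (α + β) := fun σ => by
  rw [map_add]; exact add_pos (hα σ) (hβ σ)

lemma TotallyPositive.mul {α β : K} (hα : TotallyPositive α) (hβ : TotallyPositive β) :
    TotallyPositive (α * β) := fun σ => by
  rw [map_mul]; exact mul_pos (hα σ) (hβ σ)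

lemma TotallyPositive.inv {α : K} (hα : TotallyPositive α) : TotallyPositive α⁻¹ := fun σ => by
  rw [map_inv₀]; exact inv_pos.2 (hα σ)

/-- `u` is a totally positive unit of the order `O`. -/
def IsTotPosUnit (O : Subalgebra ℤ K) (u : K) : Prop :=
  u ≠ 0 ∧ u ∈ O ∧ u⁻¹ ∈ O ∧ TotallyPositive u

lemma IsTotPosUnit.one (O : Subalgebra ℤ K) : IsTotPosUnit O 1 :=
  ⟨one_ne_zero, one_mem _, by simp, fun σ => by simp⟩

lemma IsTotPosUnit.mul {O : Subalgebra ℤ K} {u v : K} (hu : IsTotPosUnit O u)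
    (hv : IsTotPosUnit O v) : IsTotPosUnit O (u * v) :=
  ⟨mul_ne_zero hu.1 hv.1, mul_mem hu.2.1 hv.2.1,
    by rw [mul_inv]; exact mul_mem hu.2.2.1 hv.2.2.1, hu.2.2.2.mul hv.2.2.2⟩

lemma IsTotPosUnit.inv {O : Subalgebra ℤ K} {u : K} (hu : IsTotPosUnit O u) :
    IsTotPosUnit O u⁻¹ :=
  ⟨inv_ne_zero hu.1, hu.2.2.1, by rw [inv_inv]; exact hu.2.1, hu.2.2.2.inv⟩

lemma IsIndecomposableIn.unit_mul {O : Subalgebra ℤ K} {u α : K} (hu : IsTotPosUnit O u)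
    (hα : IsIndecomposableIn O α) : IsIndecomposableIn O (u * α) := by
  refine ⟨⟨mul_mem hu.2.1 hα.1.1, hu.2.2.2.mul hα.1.2⟩, ?_⟩
  rintro ⟨β, γ, hβ, hγ, h⟩
  refine hα.2 ⟨u⁻¹ * β, u⁻¹ * γ, ⟨mul_mem hu.2.2.1 hβ.1, hu.2.2.2.inv.mul hβ.2⟩,
    ⟨mul_mem hu.2.2.1 hγ.1, hu.2.2.2.inv.mul hγ.2⟩, ?_⟩
  rw [← mul_add, ← h, inv_mul_cancel_left₀ hu.1]

lemma codifferentTraces_unit_mul_subset [NumberField K] {O : Subalgebra ℤ K} {u : K}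
    (hu : IsTotPosUnit O u) (α : K) : codifferentTraces O (u * α) ⊆ codifferentTraces O α := by
  rintro s ⟨δ, hδ, hpos, rfl⟩
  refine ⟨u * δ, fun β hβ => ?_, hu.2.2.2.mul hpos, by congr 1; ring⟩
  obtain ⟨n, hn⟩ := hδ (β * u) (mul_mem hβ hu.2.1)
  exact ⟨n, by rw [← hn]; congr 1; ring⟩

lemma embedding_add_pos (ha : 2 ≤ a) (hc : 2 ≤ c) (ht : t * (t + a) * (t - c) = 1)
    (σ : K →+* ℝ) : 0 < σ t + a := by
  have h := embedding_root ht σ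
  have ha' : (2 : ℝ) ≤ a := by exact_mod_cast ha
  have hc' : (2 : ℝ) ≤ c := by exact_mod_cast hc
  by_contra! h0
  have := mul_pos (show 0 < -σ t by linarith) (show 0 < c - σ t by linarith)
  nlinarith

lemma isTotPosUnit_add (ha : 2 ≤ a) (hc : 2 ≤ c) (ht : t * (t + a) * (t - c) = 1) :
    IsTotPosUnit (Algebra.adjoin ℤ {t}) (t + a) := by
  have hmul : (t + a) * (t * (t - c)) = 1 := by linear_combination ht
  refine ⟨left_ne_zero_of_mul_eq_one hmul, ?_, ?_, fun σ => ?_⟩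
  · exact (mem_adjoin_iff_exists_coords ht).2 ⟨a, 1, 0, by push_cast; ring⟩
  · rw [inv_eq_of_mul_eq_one_right hmul]
    exact (mem_adjoin_iff_exists_coords ht).2 ⟨0, -c, 1, by push_cast; ring⟩
  · rw [map_add, map_intCast]; exact embedding_add_pos ha hc ht σ

lemma isTotPosUnit_sq (ht : t * (t + a) * (t - c) = 1) :
    IsTotPosUnit (Algebra.adjoin ℤ {t}) (t ^ 2) := by
  have hmul : t * ((t + a) * (t - c)) = 1 := by linear_combination ht
  have ht0 : t ≠ 0 := left_ne_zero_of_mul_eq_one hmul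
  refine ⟨pow_ne_zero 2 ht0, ?_, ?_, fun σ => ?_⟩
  · exact (mem_adjoin_iff_exists_coords ht).2 ⟨0, 0, 1, by push_cast; ring⟩
  · rw [← inv_pow, inv_eq_of_mul_eq_one_right hmul]
    exact pow_mem ((mem_adjoin_iff_exists_coords ht).2
      ⟨-(a * c), a - c, 1, by push_cast; ring⟩) 2
  · rw [map_pow]
    have := (map_ne_zero σ).2 ht0
    positivity

/-- Coordinates `(x, y, z)` with respect to `1`, `t`, `t²` of a point in the closed cone spanned by
the units `1`, `ρ` and `ρ t²`, where `ρ = t + a`. -/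
def InConeOne (a c x y z : ℤ) : Prop :=
  0 ≤ z ∧ a * z ≤ y ∧ z ≤ c * (x - a * (y - a * z))

/-- Coordinates `(x, y, z)` with respect to `1`, `t`, `t²` of a point in the closed cone spanned by
the units `1`, `ρ t²` and `t²`, where `ρ = t + a`. -/
def InConeTwo (a c x y z : ℤ) : Prop :=
  0 ≤ y ∧ y ≤ c * a * x ∧ y ≤ a * z

lemma one_add_mul_embedding_pos (ha : 2 ≤ a) (hc : 2 ≤ c) (ht : t * (t + a) * (t - c) = 1)
    (σ : K →+* ℝ) : 0 < 1 + a * c * σ t + c * σ t ^ 2 := by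
  -- The number is the image of the unit `(t + a) t²`.
  have h := embedding_root ht σ
  have h1 := embedding_add_pos ha hc ht σ
  have h2 : 0 < σ t ^ 2 := by
    have : σ t ≠ 0 := left_ne_zero_of_mul_eq_one (by rw [← mul_assoc]; exact h)
    positivity
  nlinarith [mul_pos h1 h2]

lemma InConeOne.totallyPositive (ha : 2 ≤ a) (hc : 2 ≤ c) (ht : t * (t + a) * (t - c) = 1)
    {x y z : ℤ} (h : InConeOne a c x y z) (h0 : ¬ (x = 0 ∧ y = 0 ∧ z = 0)) :
    TotallyPositive (x + y * t + z * t ^ 2 : K) := by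
  intro σ
  obtain ⟨h1, h2, h3⟩ := h
  have e1 := embedding_add_pos ha hc ht σ
  have e2 := one_add_mul_embedding_pos ha hc ht σ
  have hc' : (0 : ℝ) < c := by exact_mod_cast (by omega : 0 < c)
  simp only [map_add, map_mul, map_pow, map_intCast]
  have A : (0 : ℝ) ≤ c * (x - a * (y - a * z)) - z := by exact_mod_cast sub_nonneg.2 h3
  have B : (0 : ℝ) ≤ y - a * z := by exact_mod_cast sub_nonneg.2 h2
  have C : (0 : ℝ) ≤ z := by exact_mod_cast h1
  have key : c * (x + y * σ t + z * σ t ^ 2) = (c * (x - a * (y - a * z)) - z) +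
      c * ((y - a * z) * (σ t + a)) + z * (1 + a * c * σ t + c * σ t ^ 2) := by ring
  refine pos_of_mul_pos_right (a := (c : ℝ)) ?_ hc'.le
  rw [key]
  have B' := mul_nonneg hc'.le (mul_nonneg B e1.le)
  have C' := mul_nonneg C e2.le
  rcases h1.lt_or_eq with hz | rfl
  · have : (0 : ℝ) < z := by exact_mod_cast hz
    have := mul_pos this e2
    linarith
  rcases h2.lt_or_eq with hy | hy
  · have : (0 : ℝ) < y - a * (0 : ℤ) := by exact_mod_cast sub_pos.2 hy
    have := mul_pos hc' (mul_pos this e1)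
    linarith
  obtain rfl : y = 0 := by linarith
  have hx : 0 < x := by
    rcases lt_trichotomy x 0 with hx | hx | hx
    · nlinarith
    · exact absurd ⟨hx, rfl, rfl⟩ h0
    · exact hx
  have : (0 : ℝ) < c * x := mul_pos hc' (by exact_mod_cast hx)
  push_cast
  linarith

lemma InConeTwo.totallyPositive (ha : 2 ≤ a) (hc : 2 ≤ c) (ht : t * (t + a) * (t - c) = 1)
    {x y z : ℤ} (h : InConeTwo a c x y z) (h0 : ¬ (x = 0 ∧ y = 0 ∧ z = 0)) :
    TotallyPositive (x + y * t + z * t ^ 2 : K) := by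
  intro σ
  obtain ⟨h1, h2, h3⟩ := h
  have e2 := one_add_mul_embedding_pos ha hc ht σ
  have e1 : 0 < σ t ^ 2 := by
    have : σ t ≠ 0 := left_ne_zero_of_mul_eq_one (by rw [← mul_assoc]; exact embedding_root ht σ)
    positivity
  have hc' : (0 : ℝ) < c := by exact_mod_cast (by omega : 0 < c)
  have ha' : (0 : ℝ) < a := by exact_mod_cast (by omega : 0 < a)
  simp only [map_add, map_mul, map_pow, map_intCast]
  have A : (0 : ℝ) ≤ c * a * x - y := by exact_mod_cast sub_nonneg.2 h2
  have B : (0 : ℝ) ≤ y := by exact_mod_cast h1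
  have C : (0 : ℝ) ≤ a * z - y := by exact_mod_cast sub_nonneg.2 h3
  have key : c * a * (x + y * σ t + z * σ t ^ 2) = (c * a * x - y) +
      y * (1 + a * c * σ t + c * σ t ^ 2) + c * ((a * z - y) * σ t ^ 2) := by ring
  refine pos_of_mul_pos_right (a := (c * a : ℝ)) ?_ (by positivity)
  rw [key]
  have B' := mul_nonneg B e2.le
  have C' := mul_nonneg hc'.le (mul_nonneg C e1.le)
  rcases h1.lt_or_eq with hy | rfl
  · have : (0 : ℝ) < y := by exact_mod_cast hy
    have := mul_pos this e2
    linarith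
  rcases h3.lt_or_eq with hz | hz
  · have : (0 : ℝ) < a * z - (0 : ℤ) := by exact_mod_cast sub_pos.2 hz
    have := mul_pos hc' (mul_pos this e1)
    linarith
  obtain rfl : z = 0 := by
    rcases mul_eq_zero.1 hz.symm with h | h
    · omega
    · exact h
  have hx : 0 < x := by
    rcases lt_trichotomy x 0 with hx | hx | hx
    · have := mul_pos (show 0 < c by omega) (show 0 < a by omega)
      nlinarith
    · exact absurd ⟨hx, rfl, rfl⟩ h0
    · exact hx
  have : (0 : ℝ) < c * a * x := mul_pos (by positivity) (by exact_mod_cast hx)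
  push_cast
  linarith

end Order

/-! ### The two cones cover the totally positive elements up to units -/

section Cover

variable {K : Type*} [Field K] [NumberField K] {a c : ℤ} {t : K}

/-- Up to totally positive units, every totally positive element of the order lies in one of the
two cones. Moreover its height there is at most its height with respect to the second cone.

Let `φ₁`, `φ₂` be the functionals with value `a` at the generators of the first and of the second
cone. Their values at totally positive elements of the order are positive integers, so there are
a unit `u` and an index `i` for which `φᵢ (u β)` is minimal. Comparing this value with those of the
other functional at three unit multiples of `u β`, which corresponds to the three triangles
adjacent to the base of the cone, shows that the coefficients of `u β` with respect to the
generators of the cone are nonnegative. -/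
lemma exists_unit_mul_mem_cone (ha : 2 ≤ a) (hc : 2 ≤ c) (ht : t * (t + a) * (t - c) = 1)
    (hK : IntermediateField.adjoin ℚ {t} = ⊤) {x₀ y₀ z₀ : ℤ}
    (hβ : TotallyPositive (x₀ + y₀ * t + z₀ * t ^ 2 : K)) :
    ∃ u : K, IsTotPosUnit (Algebra.adjoin ℤ {t}) u ∧ ∃ x y z : ℤ,
      u * (x₀ + y₀ * t + z₀ * t ^ 2) = x + y * t + z * t ^ 2 ∧
      ((InConeOne a c x y z ∧
          a * (x - (a - 1) * y + a * (a - 1) * z) ≤ a * x₀ - y₀ + a * z₀) ∨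
        (InConeTwo a c x y z ∧ a * x - y + a * z ≤ a * x₀ - y₀ + a * z₀)) := by
  classical
  obtain ⟨δ₁, hδ₁, tr₁⟩ := exists_functional_cone_one ha hc ht hK
  obtain ⟨δ₂, hδ₂, tr₂⟩ := exists_functional_cone_two ha hc ht hK
  set β : K := x₀ + y₀ * t + z₀ * t ^ 2 with hβdef
  set O := Algebra.adjoin ℤ {t}
  let orb : ℤ → ℤ → ℤ → Prop := fun x y z =>
    ∃ u : K, IsTotPosUnit O u ∧ u * β = x + y * t + z * t ^ 2
  let N₁ : ℤ → ℤ → ℤ → ℤ := fun x y z => a * (x - (a - 1) * y + a * (a - 1) * z)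
  let N₂ : ℤ → ℤ → ℤ → ℤ := fun x y z => a * x - y + a * z
  have pos₁ : ∀ {x y z}, orb x y z → 0 < N₁ x y z := by
    rintro x y z ⟨u, hu, e⟩
    have h := trace_mul_pos ha hc ht hK (hu.2.2.2.mul hβ) hδ₁
    rw [e, tr₁] at h
    have h' := Int.cast_pos.1 h
    exact mul_pos (by omega) (by linarith)
  have pos₂ : ∀ {x y z}, orb x y z → 0 < N₂ x y z := by
    rintro x y z ⟨u, hu, e⟩
    have h := trace_mul_pos ha hc ht hK (hu.2.2.2.mul hβ) hδ₂
    rw [e, tr₂] at h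
    have h' := Int.cast_pos.1 h
    simp only [N₂]
    linarith
  let P : ℕ → Prop := fun n => ∃ x y z, orb x y z ∧ ((n : ℤ) = N₁ x y z ∨ (n : ℤ) = N₂ x y z)
  have orb₀ : orb x₀ y₀ z₀ := ⟨1, .one O, one_mul _⟩
  have hP : ∃ n, P n := ⟨(N₂ x₀ y₀ z₀).toNat, x₀, y₀, z₀, orb₀,
    Or.inr (Int.toNat_of_nonneg (pos₂ orb₀).le)⟩
  set n := Nat.find hP
  have min₁ : ∀ {x y z}, orb x y z → (n : ℤ) ≤ N₁ x y z := fun {x y z} h => by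
    have e := Int.toNat_of_nonneg (pos₁ h).le
    rw [← e, Int.ofNat_le]
    exact Nat.find_min' hP ⟨x, y, z, h, Or.inl e⟩
  have min₂ : ∀ {x y z}, orb x y z → (n : ℤ) ≤ N₂ x y z := fun {x y z} h => by
    have e := Int.toNat_of_nonneg (pos₂ h).le
    rw [← e, Int.ofNat_le]
    exact Nat.find_min' hP ⟨x, y, z, h, Or.inr e⟩
  obtain ⟨x, y, z, ho, hn⟩ := Nat.find_spec hP
  have hle := min₂ orb₀
  have step : ∀ {v : K} {x' y' z' : ℤ}, IsTotPosUnit O v →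
      v * (x + y * t + z * t ^ 2) = x' + y' * t + z' * t ^ 2 → orb x' y' z' := by
    rintro v x' y' z' hv e
    obtain ⟨u, hu, hu'⟩ := ho
    exact ⟨v * u, hv.mul hu, by rw [mul_assoc, hu', e]⟩
  have uρ := isTotPosUnit_add ha hc ht
  have uT := isTotPosUnit_sq ht
  obtain ⟨u, hu, hu'⟩ := ho
  refine ⟨u, hu, x, y, z, hu', ?_⟩
  -- The orbit points adjacent to `(x, y, z)`: its multiples by `t²`, `t⁻²`, `ρ` and `ρ⁻¹`.
  have oT : orb (y + z * (c - a)) (y * (a * c) + z * (1 + (c - a) * (a * c)))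
      (x + y * (c - a) + z * ((c - a) ^ 2 + a * c)) := step uT (by
    push_cast
    linear_combination (y + z * (t + (c - a)) : K) * ht)
  have oρ : orb (a * x + z) (x + a * y + a * c * z) (y + c * z) := step uρ (by
    push_cast
    linear_combination (z : K) * ht)
  have oρ' : orb (y - a * z) (z + a * c * (y - a * z) - c * x) (x - a * (y - a * z)) :=
    step uρ.inv (by
      rw [inv_mul_eq_iff_eq_mul₀ uρ.1]
      push_cast
      linear_combination -(x - a * (y - a * z) : K) * ht)
  have oT' : orb (z + (a - c) * x - a * c * (y - a * c * x)) (x + (a - c) * (y - a * c * x))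
      (y - a * c * x) := step uT.inv (by
    rw [inv_mul_eq_iff_eq_mul₀ uT.1]
    push_cast
    linear_combination (-x - t * (y - a * c * x) : K) * ht)
  have hac : 0 < a * c - 1 := by nlinarith
  have haa : 0 < a ^ 2 - a - 1 := by nlinarith
  rcases hn with hn | hn
  · -- The three inequalities are, up to positive factors, the nonnegativity of the coefficients
    -- at `ρ t²`, at `ρ` and at `1`.
    refine Or.inl ⟨⟨?_, ?_, ?_⟩, hn.symm.le.trans hle⟩
    · refine nonneg_of_mul_nonneg_right ?_ hac
      have := hn.symm.le.trans (min₂ oT)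
      simp only [N₁, N₂] at this
      linarith
    · refine sub_nonneg.1 (nonneg_of_mul_nonneg_right ?_ haa)
      have := hn.symm.le.trans (min₂ ⟨u, hu, hu'⟩)
      simp only [N₁, N₂] at this
      linarith
    · have := hn.symm.le.trans (min₂ oρ')
      simp only [N₁, N₂] at this
      linarith
  · -- Here they are the nonnegativity of the coefficients at `ρ t²`, at `1` and at `t²`.
    refine Or.inr ⟨⟨?_, ?_, ?_⟩, hn.symm.le.trans hle⟩
    · have := hn.symm.le.trans (min₁ oρ)
      simp only [N₁, N₂] at this
      linarith
    · refine sub_nonneg.1 (nonneg_of_mul_nonneg_right ?_ hac)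
      have := hn.symm.le.trans (min₁ oT')
      simp only [N₁, N₂] at this
      linarith
    · refine sub_nonneg.1 (nonneg_of_mul_nonneg_right ?_ haa)
      have := hn.symm.le.trans (min₁ ⟨u, hu, hu'⟩)
      simp only [N₁, N₂] at this
      linarith

end Cover

/-! ### Indecomposable elements in the cones -/

section Indecomposables

variable {K : Type*} [Field K] {a c : ℤ} {t : K}

lemma IsIndecomposableIn.ne_zero {O : Subalgebra ℤ K} {α : K} (hα : IsIndecomposableIn O α) :
    α ≠ 0 := by
  rintro rfl
  exact hα.2 ⟨0, 0, hα.1, hα.1, by simp⟩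

/-- An indecomposable element of the second cone is `t²`, or has constant coordinate `1` and lies
less than `t²` above the face spanned by `1` and `ρ t²`: otherwise one of the generators `1`,
`ρ t²`, `t²` of the cone can be subtracted without leaving the cone. -/
lemma IsIndecomposableIn.coords_of_inConeTwo (ha : 2 ≤ a) (hc : 2 ≤ c)
    (ht : t * (t + a) * (t - c) = 1) {x y z : ℤ} (h : InConeTwo a c x y z)
    (hα : IsIndecomposableIn (Algebra.adjoin ℤ {t}) (x + y * t + z * t ^ 2 : K)) :
    (x = 0 ∧ y = 0 ∧ z = 1) ∨ (x = 1 ∧ y ≤ c * a ∧ a * z - y < a) := by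
  have hca : 0 < c * a := mul_pos (by omega) (by omega)
  -- Subtracting an element of the cone from `α` leaves the cone, unless it equals `α`.
  have key : ∀ x' y' z' : ℤ, InConeTwo a c x' y' z' → ¬ (x' = 0 ∧ y' = 0 ∧ z' = 0) →
      InConeTwo a c (x - x') (y - y') (z - z') → x = x' ∧ y = y' ∧ z = z' := by
    intro x' y' z' h1 h2 h3
    by_contra h4
    refine hα.2 ⟨_, _, ⟨(mem_adjoin_iff_exists_coords ht).2 ⟨x', y', z', rfl⟩,
      h1.totallyPositive ha hc ht h2⟩, ⟨(mem_adjoin_iff_exists_coords ht).2 ⟨_, _, _, rfl⟩,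
      h3.totallyPositive ha hc ht (by omega)⟩, ?_⟩
    push_cast
    ring
  obtain ⟨h1, h2, h3⟩ := h
  by_cases hx : x ≤ 0
  · have hy : y = 0 := by nlinarith
    have hx' : x = 0 := by nlinarith
    subst hy hx'
    have hz : z ≠ 0 := by
      rintro rfl
      exact hα.ne_zero (by simp)
    have hz' : 1 ≤ z := by
      have : 0 ≤ z := by nlinarith
      omega
    have := key 0 0 1 ⟨le_rfl, by simp, by omega⟩ (by simp) ⟨by simp, by simp, by nlinarith⟩
    omega
  · have hx1 : x = 1 := by
      by_contra hx1
      by_cases h4 : y ≤ c * a * (x - 1)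
      · have := key 1 0 0 ⟨le_rfl, by omega, by simp⟩ (by simp) ⟨by simpa, by simpa, by simpa⟩
        exact hx1 this.1
      · have h5 : c * a ≤ y := by nlinarith [show 1 ≤ x - 1 by omega]
        have := key 1 (c * a) c ⟨hca.le, by simp, by linarith⟩ (by simp)
          ⟨by linarith, by linarith, by linarith⟩
        exact hx1 this.1
    subst hx1
    refine Or.inr ⟨rfl, by linarith, ?_⟩
    by_contra h4
    have := key 0 0 1 ⟨le_rfl, by simp, by omega⟩ (by simp) ⟨by simpa, by simpa using h2, by linarith⟩
    omega

/-- An indecomposable element of the first cone lies in the plane through the units `1`, `ρ` and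
`ρ t²` that generate the cone. -/
lemma IsIndecomposableIn.height_of_inConeOne (ha : 2 ≤ a) (hc : 2 ≤ c)
    (ht : t * (t + a) * (t - c) = 1) {x y z : ℤ} (h : InConeOne a c x y z)
    (hα : IsIndecomposableIn (Algebra.adjoin ℤ {t}) (x + y * t + z * t ^ 2 : K)) :
    x - (a - 1) * y + a * (a - 1) * z = 1 := by
  have key : ∀ x' y' z' : ℤ, InConeOne a c x' y' z' → ¬ (x' = 0 ∧ y' = 0 ∧ z' = 0) →
      InConeOne a c (x - x') (y - y') (z - z') → x = x' ∧ y = y' ∧ z = z' := by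
    intro x' y' z' h1 h2 h3
    by_contra h4
    refine hα.2 ⟨_, _, ⟨(mem_adjoin_iff_exists_coords ht).2 ⟨x', y', z', rfl⟩,
      h1.totallyPositive ha hc ht h2⟩, ⟨(mem_adjoin_iff_exists_coords ht).2 ⟨_, _, _, rfl⟩,
      h3.totallyPositive ha hc ht (by omega)⟩, ?_⟩
    push_cast
    ring
  obtain ⟨h1, h2, h3⟩ := h
  rcases h2.lt_or_eq with h4 | rfl
  · obtain ⟨rfl, rfl, rfl⟩ := key a 1 0 ⟨le_rfl, by simp, by simp⟩ (by simp)
      ⟨by simpa, by linarith [Int.add_one_le_of_lt h4], by linarith⟩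
    ring
  · simp only [sub_self, mul_zero, sub_zero] at h3
    have hx : x = 1 := by
      by_contra hx
      by_cases h4 : z ≤ c * (x - 1)
      · exact hx (key 1 0 0 ⟨le_rfl, by simp, by simp; omega⟩ (by simp)
          ⟨by simpa, by simp, by simpa using h4⟩).1
      · by_cases hx0 : x ≤ 0
        · have hz : z = 0 := by nlinarith
          have hx' : x = 0 := by nlinarith
          subst hz hx'
          exact hα.ne_zero (by simp)
        · have h5 : c ≤ z := by nlinarith [show 1 ≤ x - 1 by omega]
          exact hx (key 1 (a * c) c ⟨by omega, le_rfl, by simp⟩ (by simp)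
            ⟨by omega, by linarith, by linarith⟩).1
    subst hx
    ring

end Indecomposables

/-! ### Minimal traces -/

section Main

variable {K : Type*} [Field K] [NumberField K] {a c : ℤ} {t : K}

lemma mem_codifferent_of_trace_mul_eq (ht : t * (t + a) * (t - c) = 1) {δ : K} {p q r : ℤ}
    (h : ∀ x y z : ℤ, Algebra.trace ℚ K ((x + y * t + z * t ^ 2) * δ) =
      ((p * x + q * y + r * z : ℤ) : ℚ)) : δ ∈ codifferent (Algebra.adjoin ℤ {t}) := by
  intro α hα
  obtain ⟨x, y, z, rfl⟩ := (mem_adjoin_iff_exists_coords ht).1 hα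
  exact ⟨_, h x y z⟩

/-- After multiplication by a unit, a suitable explicit functional takes a value at most
`min (c + 1) a` at an indecomposable element. -/
lemma exists_mem_codifferentTraces_le (ha : 2 ≤ a) (hc : 2 ≤ c)
    (ht : t * (t + a) * (t - c) = 1) (hK : IntermediateField.adjoin ℚ {t} = ⊤) {α : K}
    (hα : IsIndecomposableIn (Algebra.adjoin ℤ {t}) α) :
    ∃ n : ℤ, (n : ℚ) ∈ codifferentTraces (Algebra.adjoin ℤ {t}) α ∧ n ≤ min (c + 1) a := by
  obtain ⟨x₀, y₀, z₀, rfl⟩ := (mem_adjoin_iff_exists_coords ht).1 hα.1.1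
  obtain ⟨u, hu, x, y, z, e, h⟩ := exists_unit_mul_mem_cone ha hc ht hK hα.1.2
  have hα' := hα.unit_mul hu
  rw [e] at hα'
  suffices ∃ n : ℤ, (n : ℚ) ∈ codifferentTraces (Algebra.adjoin ℤ {t})
      (x + y * t + z * t ^ 2 : K) ∧ n ≤ min (c + 1) a by
    obtain ⟨n, hn, hle⟩ := this
    exact ⟨n, codifferentTraces_unit_mul_subset hu _ (e ▸ hn), hle⟩
  rcases h with ⟨h, -⟩ | ⟨h, -⟩
  · obtain ⟨δ, hδ, tr⟩ := exists_functional_cone_one ha hc ht hK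
    have := hα'.height_of_inConeOne ha hc ht h
    exact ⟨_, ⟨δ, mem_codifferent_of_trace_mul_eq ht tr, hδ, (tr x y z).symm⟩,
      le_min (by linarith) (by linarith)⟩
  · rcases le_total (c + 1) a with hm | hm
    · obtain ⟨δ, hδ, tr⟩ := exists_functional_le_right ha hc ht hK
      refine ⟨_, ⟨δ, mem_codifferent_of_trace_mul_eq ht tr, hδ, (tr x y z).symm⟩, ?_⟩
      rw [min_eq_left hm]
      rcases hα'.coords_of_inConeTwo ha hc ht h with ⟨rfl, rfl, rfl⟩ | ⟨rfl, h1, h2⟩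
      · linarith
      · have : z < c + 1 := lt_of_mul_lt_mul_left (a := a) (by linarith) (by omega)
        linarith
    · obtain ⟨δ, hδ, tr⟩ := exists_functional_le_left ha hc ht hK
      refine ⟨_, ⟨δ, mem_codifferent_of_trace_mul_eq ht tr, hδ, (tr x y z).symm⟩, ?_⟩
      rw [min_eq_right hm]
      rcases hα'.coords_of_inConeTwo ha hc ht h with ⟨rfl, rfl, rfl⟩ | ⟨rfl, h1, h2⟩ <;>
        linarith

lemma exists_isLeast_codifferentTraces (ha : 2 ≤ a) (hc : 2 ≤ c)
    (ht : t * (t + a) * (t - c) = 1) (hK : IntermediateField.adjoin ℚ {t} = ⊤) {α : K}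
    (hα : α ∈ Algebra.adjoin ℤ {t}) (hpos : TotallyPositive α) {n : ℤ}
    (hn : (n : ℚ) ∈ codifferentTraces (Algebra.adjoin ℤ {t}) α) :
    ∃ m : ℤ, IsLeast (codifferentTraces (Algebra.adjoin ℤ {t}) α) (m : ℚ) ∧ m ≤ n := by
  obtain ⟨m, hm, hmin⟩ := Int.exists_least_of_bdd
    (P := fun k : ℤ => (k : ℚ) ∈ codifferentTraces (Algebra.adjoin ℤ {t}) α)
    ⟨0, by
      rintro k ⟨δ, -, hδ, hk⟩
      have := trace_mul_pos ha hc ht hK hpos hδ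
      rw [← hk] at this
      exact_mod_cast this.le⟩ ⟨n, hn⟩
  refine ⟨m, ⟨hm, ?_⟩, hmin n hn⟩
  rintro s hs
  obtain ⟨δ, hδ, hδpos, rfl⟩ := hs
  obtain ⟨k, hk⟩ := hδ α hα
  rw [hk]
  exact_mod_cast hmin k ⟨δ, hδ, hδpos, hk.symm⟩

/-- The height with respect to the second cone, scaled to have value `a` at the generators, is at
least `a` on all totally positive elements of the order. -/
lemma le_height_of_totallyPositive (ha : 2 ≤ a) (hc : 2 ≤ c)
    (ht : t * (t + a) * (t - c) = 1) (hK : IntermediateField.adjoin ℚ {t} = ⊤) {x₀ y₀ z₀ : ℤ}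
    (hβ : TotallyPositive (x₀ + y₀ * t + z₀ * t ^ 2 : K)) : a ≤ a * x₀ - y₀ + a * z₀ := by
  obtain ⟨u, hu, x, y, z, e, ⟨-, hle⟩ | ⟨⟨h1, h2, h3⟩, hle⟩⟩ :=
    exists_unit_mul_mem_cone ha hc ht hK hβ
  · obtain ⟨δ, hδ, tr⟩ := exists_functional_cone_one ha hc ht hK
    have h := trace_mul_pos ha hc ht hK (hu.2.2.2.mul hβ) hδ
    rw [e, tr] at h
    have h' : 1 ≤ x - (a - 1) * y + a * (a - 1) * z := by
      have := Int.cast_pos.1 h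
      linarith [Int.add_one_le_of_lt this]
    exact le_trans (by nlinarith) hle
  · refine le_trans ?_ hle
    by_cases hx : 1 ≤ x
    · nlinarith
    · have hca : 0 < c * a := mul_pos (by omega) (by omega)
      have hy : y = 0 := by nlinarith
      have hx' : x = 0 := by nlinarith
      subst hy hx'
      obtain ⟨δ, hδ, tr⟩ := exists_functional_cone_two ha hc ht hK
      have h := trace_mul_pos ha hc ht hK (hu.2.2.2.mul hβ) hδ
      rw [e, tr] at h
      have := Int.cast_pos.1 h
      have hz : 0 < z := by nlinarith
      nlinarith

/-- The element `ρ t² - (a - 1) t` of the second cone, whose minimal trace is the largest. -/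
lemma isIndecomposableIn_extremal (ha : 2 ≤ a) (hc : 2 ≤ c)
    (ht : t * (t + a) * (t - c) = 1) (hK : IntermediateField.adjoin ℚ {t} = ⊤) :
    IsIndecomposableIn (Algebra.adjoin ℤ {t})
      ((1 : ℤ) + (c * a - a + 1 : ℤ) * t + (c : ℤ) * t ^ 2 : K) := by
  have hcone : InConeTwo a c 1 (c * a - a + 1) c := ⟨by nlinarith, by linarith, by linarith⟩
  refine ⟨⟨(mem_adjoin_iff_exists_coords ht).2 ⟨_, _, _, rfl⟩,
    hcone.totallyPositive ha hc ht (by simp)⟩, ?_⟩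
  rintro ⟨β, γ, ⟨hβ, hβ'⟩, ⟨hγ, hγ'⟩, h⟩
  obtain ⟨x, y, z, rfl⟩ := (mem_adjoin_iff_exists_coords ht).1 hβ
  obtain ⟨x', y', z', rfl⟩ := (mem_adjoin_iff_exists_coords ht).1 hγ
  have h1 := le_height_of_totallyPositive ha hc ht hK hβ'
  have h2 := le_height_of_totallyPositive ha hc ht hK hγ'
  -- The height of the element is `2 a - 1`, so it is not a sum of two heights `≥ a`.
  obtain ⟨δ, -, tr⟩ := exists_functional_cone_two ha hc ht hK
  have h3 := congrArg (fun v => Algebra.trace ℚ K (v * δ)) h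
  have h4 := h3.trans ((congrArg _ (add_mul _ _ δ)).trans (map_add _ _ _))
  simp only [tr] at h4
  have h5 : a * 1 + (-1) * (c * a - a + 1) + a * c =
      (a * x + (-1) * y + a * z) + (a * x' + (-1) * y' + a * z') := by exact_mod_cast h4
  linarith

/-- Every totally positive element of the codifferent has trace at least `min (c + 1) a` against
the extremal element, since its traces against the units `1`, `t²` and `ρ t²` are at least `1`. -/
lemma min_le_trace_extremal (ha : 2 ≤ a) (hc : 2 ≤ c)
    (ht : t * (t + a) * (t - c) = 1) (hK : IntermediateField.adjoin ℚ {t} = ⊤) {s : ℚ}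
    (hs : s ∈ codifferentTraces (Algebra.adjoin ℤ {t})
      ((1 : ℤ) + (c * a - a + 1 : ℤ) * t + (c : ℤ) * t ^ 2 : K)) :
    ((min (c + 1) a : ℤ) : ℚ) ≤ s := by
  obtain ⟨δ, hδ, hpos, rfl⟩ := hs
  have uρ := isTotPosUnit_add ha hc ht
  have uT := isTotPosUnit_sq ht
  obtain ⟨P, hP⟩ := hδ 1 (one_mem _)
  obtain ⟨Q, hQ⟩ := hδ t (Algebra.self_mem_adjoin_singleton ℤ t)
  obtain ⟨R, hR⟩ := hδ (t ^ 2) uT.2.1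
  have tr : ∀ x y z : ℤ, Algebra.trace ℚ K ((x + y * t + z * t ^ 2) * δ) =
      ((P * x + Q * y + R * z : ℤ) : ℚ) := by
    intro x y z
    have e : ((x + y * t + z * t ^ 2) * δ : K) =
        (x : ℚ) • (1 * δ) + (y : ℚ) • (t * δ) + (z : ℚ) • (t ^ 2 * δ) := by
      simp only [Algebra.smul_def, map_intCast]
      ring
    rw [e]
    simp only [map_add, map_smul, hP, hQ, hR, smul_eq_mul]
    push_cast
    ring
  have h1 : 1 ≤ P := by
    have h := trace_mul_pos ha hc ht hK (IsTotPosUnit.one (Algebra.adjoin ℤ {t})).2.2.2 hpos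
    rw [hP] at h
    exact_mod_cast h
  have h2 : 1 ≤ R := by
    have h := trace_mul_pos ha hc ht hK uT.2.2.2 hpos
    rw [hR] at h
    exact_mod_cast h
  have h3 : 1 ≤ P + Q * (a * c) + R * c := by
    have h := trace_mul_pos ha hc ht hK (uρ.mul uT).2.2.2 hpos
    have e : (t + a) * t ^ 2 = (1 : ℤ) + (a * c : ℤ) * t + (c : ℤ) * t ^ 2 := by
      push_cast
      linear_combination ht
    rw [e, tr, mul_one] at h
    exact_mod_cast h
  rw [tr]
  refine Int.cast_le.2 ?_
  rcases le_or_gt 0 Q with hQ | hQ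
  · refine (min_le_left _ _).trans ?_
    have := mul_nonneg hQ (show 0 ≤ c * a - a + 1 by nlinarith)
    nlinarith
  · refine (min_le_right _ _).trans ?_
    nlinarith

end Main

theorem mainTheorem7 {K : Type*} [Field K] [NumberField K] (a b : ℤ) (ha : 2 ≤ a)
    (hab : a ≤ b - 2) (ρ : K) (hρ : aeval ρ (thomasPolynomial a b) = 0)
    (hK : IntermediateField.adjoin ℚ {ρ} = ⊤) :
    (∀ α : K, IsIndecomposableIn (Algebra.adjoin ℤ {ρ}) α →
      ∃ m : ℤ, IsLeast (codifferentTraces (Algebra.adjoin ℤ {ρ}) α) (m : ℚ) ∧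
        m ≤ min (b - a + 1) a) ∧
    (∃ α : K, IsIndecomposableIn (Algebra.adjoin ℤ {ρ}) α ∧
      IsLeast (codifferentTraces (Algebra.adjoin ℤ {ρ}) α) ((min (b - a + 1) a : ℤ) : ℚ)) := by
  obtain ⟨c, rfl⟩ : ∃ c, b = a + c := ⟨b - a, by ring⟩
  obtain ⟨t, rfl⟩ : ∃ t : K, ρ = t + a := ⟨ρ - a, by ring⟩
  have hc : 2 ≤ c := by omega
  rw [add_sub_cancel_left]
  have ht : t * (t + a) * (t - c) = 1 := by
    simp only [thomasPolynomial, map_sub, map_add, map_mul, map_pow, aeval_X, map_one, eq_intCast,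
      map_intCast] at hρ
    linear_combination hρ
  have hadj : Algebra.adjoin ℤ {t + (a : K)} = Algebra.adjoin ℤ {t} := by
    refine le_antisymm (Algebra.adjoin_le ?_) (Algebra.adjoin_le ?_) <;>
      rw [Set.singleton_subset_iff]
    · exact add_mem (Algebra.self_mem_adjoin_singleton ℤ t) (intCast_mem _ a)
    · have := sub_mem (Algebra.self_mem_adjoin_singleton ℤ (t + (a : K)))
        (intCast_mem (Algebra.adjoin ℤ {t + (a : K)}) a)
      rwa [add_sub_cancel_right] at this
  have hK' : IntermediateField.adjoin ℚ {t} = ⊤ := by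
    rw [eq_top_iff, ← hK, IntermediateField.adjoin_simple_le_iff]
    exact add_mem (IntermediateField.mem_adjoin_simple_self ℚ t) (intCast_mem _ a)
  rw [hadj]
  have hfirst : ∀ α : K, IsIndecomposableIn (Algebra.adjoin ℤ {t}) α →
      ∃ m : ℤ, IsLeast (codifferentTraces (Algebra.adjoin ℤ {t}) α) (m : ℚ) ∧
        m ≤ min (c + 1) a := fun α hα => by
    obtain ⟨n, hn, hle⟩ := exists_mem_codifferentTraces_le ha hc ht hK' hα
    obtain ⟨m, hm, hmn⟩ := exists_isLeast_codifferentTraces ha hc ht hK' hα.1.1 hα.1.2 hn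
    exact ⟨m, hm, hmn.trans hle⟩
  have hext := isIndecomposableIn_extremal ha hc ht hK'
  obtain ⟨m, hm, hle⟩ := hfirst _ hext
  obtain rfl : m = min (c + 1) a :=
    le_antisymm hle (Int.cast_le.1 (min_le_trace_extremal ha hc ht hK' hm.1))
  exact ⟨hfirst, _, hext, hm⟩
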